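/- Let $A,F,Q\in\mathbb R^{n\times n}$ with $F$ and $Q$ symmetric positive definite, let $F=LL^\top$ be the Cholesky factorization of $F$ ($L$ lower triangular with positive diagonal), and put $$\mathcal R(X):=A^\top X+XA-XFX+Q .$$ A real matrix is called stable if all its eigenvalues have negative real part. Assume that the numerical range $\{x^H L^{-1}AL\,x:\ x\in\mathbb C^n,\ \|x\|_2=1\}$ is contained in the open left half-plane $\{\Re z<0\}$, and let $\tilde X_0$ be symmetric positive semidefinite such that $A-F\tilde X_0$ is stable. Fix $\alpha>0$, and let $(\tilde X_k)_{k\ge 0}$ be a sequence generated by the inexact Newton–Kleinman iteration with line search and without truncation. That is, for every $k\ge 0$, with $\tilde A_k:=A-F\tilde X_k$: * $\mathrm{vec}(\widehat X_{k+1})$ is the result, in exact arithmetic, of $\overline{it}_k\in\mathbb N$ steps of GMRES with zero initial guess applied to $\tilde{\mathcal A}_k x=-\mathrm{vec}(\tilde X_kF\tilde X_k+Q)$, where $\tilde{\mathcal A}_k:=I\otimes \tilde A_k^\top+\tilde A_k^\top\otimes I$ and $\mathrm{vec}$ stacks columns; i.e. it minimizes the Euclidean norm of the residual over the Krylov space of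 dimension parameter $\overline{it}_k$ generated by $\tilde{\mathcal A}_k$ and the right-hand side; * $\lambda_k\in(0,1]$ satisfies $$\|\mathcal R((1-\lambda_k)\tilde X_k+\lambda_k\widehat X_{k+1})\|_2\le(1-\lambda_k\alpha)\,\|\mathcal R(\tilde X_k)\|_2 ;$$ * $\tilde X_{k+1}=(1-\lambda_k)\tilde X_k+\lambda_k\widehat X_{k+1}$. Let $\tilde{\mathcal L}_k:=(L^\top\otimes L^\top)\,\tilde{\mathcal A}_k\,(L^{-\top}\otimes L^{-\top})$ (so that $-(\tilde{\mathcal L}_k+\tilde{\mathcal L}_k^\top)/2$ turns out to be positive definite), let $\kappa$ be the 2-norm condition number, and assume that for all $k\ge 0$ $$\overline{it}_k\ \ge\ 2\log\!\left((1+\sqrt2)\,\frac{\kappa(F)\,\|\tilde X_kF\tilde X_k+Q\|_F}{\lambda_{\min}(Q)}\right)\Bigg/\left(-\log\!\left(1-\frac{\lambda_{\min}\big(-(\tilde{\mathcal L}_k+\tilde{\mathcal L}_k^\top)/2\big)^2}{\lambda_{\max}(\tilde{\mathcal L}_k\tilde{\mathcal L}_k^\top)}\right)\right),$$ where the right-hand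 side is read as $0$ if the argument of the last logarithm is $0$. If there is $\bar\lambda>0$ with $\lambda_k\ge\bar\lambda$ for all $k$, then $$\|\mathcal R(\tilde X_k)\|_F\to 0 \qquad\text{and}\qquad \tilde X_k\to X^*,$$ where $X^*$ is symmetric positive definite, $\mathcal R(X^*)=0$, $A-FX^*$ is stable, and $X^*$ is the unique stabilizing solution: every $Y\in\mathbb R^{n\times n}$ with $\mathcal R(Y)=0$ such that all eigenvalues of $A-FY$ have nonpositive real part equals $X^*$. -/

import Mathlib

open Filter Topology
open scoped Matrix Kronecker

namespace Riccati

noncomputable section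

/-! ### Norms and extreme eigenvalues of real matrices -/

/-- The spectral norm `‖M‖₂`: the operator norm for the Euclidean norm. -/
def specNorm {n : ℕ} (M : Matrix (Fin n) (Fin n) ℝ) : ℝ :=
  ‖Matrix.toEuclideanCLM (n := Fin n) (𝕜 := ℝ) M‖

/-- The Frobenius norm `‖M‖_F`. -/
def frobNorm {n : ℕ} (M : Matrix (Fin n) (Fin n) ℝ) : ℝ :=
  Real.sqrt (∑ i, ∑ j, M i j ^ 2)

/-- The Euclidean norm of a vector. -/
def vecNorm {ι : Type*} [Fintype ι] (v : ι → ℝ) : ℝ :=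
  Real.sqrt (∑ i, v i ^ 2)

/-- The 2-norm condition number `κ(M) = ‖M‖₂ ‖M⁻¹‖₂` (used for invertible matrices). -/
def condNumber {n : ℕ} (M : Matrix (Fin n) (Fin n) ℝ) : ℝ :=
  specNorm M * specNorm M⁻¹

/-- The smallest eigenvalue (used for symmetric matrices, whose eigenvalues are all real;
over a field the spectrum of a matrix is its finite set of eigenvalues). -/
def lambdaMin {ι : Type*} [Fintype ι] [DecidableEq ι] (M : Matrix ι ι ℝ) : ℝ :=
  sInf (spectrum ℝ M)

/-- The largest eigenvalue (used for symmetric matrices). -/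
def lambdaMax {ι : Type*} [Fintype ι] [DecidableEq ι] (M : Matrix ι ι ℝ) : ℝ :=
  sSup (spectrum ℝ M)

/-! ### Numerical range, stability, Cholesky factor -/

/-- The numerical range `{xᴴ M x : x ∈ ℂⁿ, ‖x‖₂ = 1}` of a real matrix. -/
def numericalRange {n : ℕ} (M : Matrix (Fin n) (Fin n) ℝ) : Set ℂ :=
  {z | ∃ x : EuclideanSpace ℂ (Fin n), ‖x‖ = 1 ∧
    z = star x.ofLp ⬝ᵥ (M.map Complex.ofReal *ᵥ x.ofLp)}

/-- All complex eigenvalues of the real matrix `M` lie in the open left half-plane. -/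
def IsStable {n : ℕ} (M : Matrix (Fin n) (Fin n) ℝ) : Prop :=
  ∀ μ ∈ spectrum ℂ (M.map Complex.ofReal), μ.re < 0

/-- All complex eigenvalues of the real matrix `M` have nonpositive real part. -/
def IsWeaklyStable {n : ℕ} (M : Matrix (Fin n) (Fin n) ℝ) : Prop :=
  ∀ μ ∈ spectrum ℂ (M.map Complex.ofReal), μ.re ≤ 0

/-- `L` is the Cholesky factor of `F`: lower triangular with positive diagonal, `F = L Lᵀ`. -/
structure IsCholeskyFactor {n : ℕ} (F L : Matrix (Fin n) (Fin n) ℝ) : Prop where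
  lower : ∀ i j, i < j → L i j = 0
  diag_pos : ∀ i, 0 < L i i
  eq : F = L * Lᵀ

/-! ### The Riccati operator and the Lyapunov systems -/

/-- `R(X) = Aᵀ X + X A - X F X + Q`. -/
def residual {n : ℕ} (A F Q X : Matrix (Fin n) (Fin n) ℝ) : Matrix (Fin n) (Fin n) ℝ :=
  Aᵀ * X + X * A - X * F * X + Q

/-- The matrix of `X ↦ Mᵀ X + X M` with respect to the column-stacking `vec`,
that is `I ⊗ Mᵀ + Mᵀ ⊗ I`. -/
def lyapMatrix {n : ℕ} (M : Matrix (Fin n) (Fin n) ℝ) :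
    Matrix (Fin n × Fin n) (Fin n × Fin n) ℝ :=
  (1 : Matrix (Fin n) (Fin n) ℝ) ⊗ₖ Mᵀ + Mᵀ ⊗ₖ (1 : Matrix (Fin n) (Fin n) ℝ)

/-- The scaled Lyapunov matrix `(Lᵀ ⊗ Lᵀ) (I ⊗ Mᵀ + Mᵀ ⊗ I) (L⁻ᵀ ⊗ L⁻ᵀ)`. -/
def scaledLyapMatrix {n : ℕ} (L M : Matrix (Fin n) (Fin n) ℝ) :
    Matrix (Fin n × Fin n) (Fin n × Fin n) ℝ :=
  (Lᵀ ⊗ₖ Lᵀ) * lyapMatrix M * ((L⁻¹)ᵀ ⊗ₖ (L⁻¹)ᵀ)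

/-! ### GMRES with zero initial guess -/

/-- The Krylov space `span {b, M b, …, M ^ (m - 1) b}`. -/
def krylov {ι : Type*} [Fintype ι] [DecidableEq ι] (M : Matrix ι ι ℝ) (b : ι → ℝ) (m : ℕ) :
    Submodule ℝ (ι → ℝ) :=
  Submodule.span ℝ {v | ∃ j < m, v = (M ^ j) *ᵥ b}

/-- `x` is the result of `m` steps of GMRES (in exact arithmetic) for `M x = b`, started at `0`:
it minimizes the Euclidean norm of the residual over the `m`-th Krylov space. -/
def IsGMRESIterate {ι : Type*} [Fintype ι] [DecidableEq ι] (M : Matrix ι ι ℝ) (b : ι → ℝ)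
    (m : ℕ) (x : ι → ℝ) : Prop :=
  x ∈ krylov M b m ∧ ∀ y ∈ krylov M b m, vecNorm (b - M *ᵥ x) ≤ vecNorm (b - M *ᵥ y)

/-! ### The inexact Newton-Kleinman iteration -/

/-- A run of the inexact Newton-Kleinman iteration with line search (parameter `α`) and without
truncation. `X k` is the `k`-th iterate, `Xhat (k + 1)` the matrix returned by `it k` steps of
GMRES on the Lyapunov equation
`(A - F X_k)ᵀ Z + Z (A - F X_k) = - X_k F X_k - Q`, and `lam k` the step length. -/
structure IsNewtonKleinmanRun {n : ℕ} (A F Q : Matrix (Fin n) (Fin n) ℝ) (α : ℝ)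
    (X Xhat : ℕ → Matrix (Fin n) (Fin n) ℝ) (lam : ℕ → ℝ) (it : ℕ → ℕ) : Prop where
  gmres : ∀ k, IsGMRESIterate (lyapMatrix (A - F * X k))
    (-Matrix.vec (X k * F * X k + Q)) (it k) (Matrix.vec (Xhat (k + 1)))
  step_mem : ∀ k, 0 < lam k ∧ lam k ≤ 1
  line_search : ∀ k,
    specNorm (residual A F Q ((1 - lam k) • X k + lam k • Xhat (k + 1))) ≤
      (1 - lam k * α) * specNorm (residual A F Q (X k))
  update : ∀ k, X (k + 1) = (1 - lam k) • X k + lam k • Xhat (k + 1)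

/-- The lower bound required of the number of GMRES steps at an iterate `X`. With `S` the scaled
Lyapunov matrix at `X`, it is
`2 log ((1 + √2) κ(F) ‖X F X + Q‖_F / λ_min(Q)) / (- log (1 - μ² / λ_max(S Sᵀ)))`,
where `μ` is the smallest eigenvalue of the positive definite matrix `-(S + Sᵀ) / 2`.
If `μ² = λ_max(S Sᵀ)`, the quotient is `0`, the value it has with `- log 0 = ∞`. -/
def gmresBound {n : ℕ} (A F Q L X : Matrix (Fin n) (Fin n) ℝ) : ℝ :=
  let S := scaledLyapMatrix L (A - F * X)
  2 * Real.log ((1 + Real.sqrt 2) * (condNumber F * frobNorm (X * F * X + Q) / lambdaMin Q)) /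
    (-Real.log (1 - lambdaMin (-((1 / 2 : ℝ) • (S + Sᵀ))) ^ 2 / lambdaMax (S * Sᵀ)))

end

end Riccati

/-! The change of variables `Y = Lᵀ X L` turns `F` into the identity: `L⁻¹ (A - F X) L = L⁻¹ A L -
Lᵀ X L`. The numerical range hypothesis makes the quadratic form of `L⁻¹ A L` negative definite, and
subtracting a positive semidefinite matrix keeps it so. Hence every positive semidefinite `X` has a
stable closed loop (`isStable_closedLoop`), and the invariant to maintain is positive
semidefiniteness rather than stability.

One step maintains it (`posSemidef_of_isGMRESIterate`). Elman's estimate, carried through the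
similarity by `Lᵀ ⊗ Lᵀ` at the price of `κ(F)`, and the bound on the number of steps give a Lyapunov
residual `E` with `‖E‖_F ≤ λ_min(Q)`. The GMRES matrix then solves a Lyapunov equation with
right-hand side `-(X F X + Q + E)`, which is negative semidefinite, so it is positive semidefinite;
the update is a convex combination.

The line search makes the Riccati residuals decay geometrically. Completing a square bounds the
iterates by their residuals (`vec_congr_le_of_residual`), so they stay in a compact set of positive
semidefinite matrices. Every cluster point solves the Riccati equation and is stabilizing; a
Sylvester argument (`eq_of_residual_eq_zero`) allows only one such solution, so the whole sequence
converges to it. -/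

namespace Riccati

/-! ### Euclidean inner products of real vectors -/

section DotProduct

variable {ι : Type*} [Fintype ι]

theorem dotProduct_self_nonneg_real (v : ι → ℝ) : 0 ≤ v ⬝ᵥ v := by
  simpa using dotProduct_star_self_nonneg v

theorem dotProduct_self_pos_of_ne_zero {v : ι → ℝ} (hv : v ≠ 0) : 0 < v ⬝ᵥ v :=
  lt_of_le_of_ne (by simpa using dotProduct_star_self_nonneg v)
    fun h => hv (dotProduct_self_eq_zero.1 h.symm)

theorem dotProduct_sq_le (v w : ι → ℝ) : (v ⬝ᵥ w) ^ 2 ≤ (v ⬝ᵥ v) * (w ⬝ᵥ w) := by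
  simpa [dotProduct, pow_two] using Finset.sum_mul_sq_le_sq_mul_sq Finset.univ v w

theorem vecNorm_eq (v : ι → ℝ) : vecNorm v = Real.sqrt (v ⬝ᵥ v) := by
  simp [vecNorm, dotProduct, pow_two]

theorem dotProduct_transpose_mulVec (S : Matrix ι ι ℝ) (v w : ι → ℝ) :
    v ⬝ᵥ Sᵀ *ᵥ w = w ⬝ᵥ S *ᵥ v := by
  rw [Matrix.mulVec_transpose, dotProduct_comm, Matrix.dotProduct_mulVec]

end DotProduct

/-! ### Rayleigh quotients -/

section Rayleigh

variable {ι : Type*} [Fintype ι] [DecidableEq ι]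

theorem finite_spectrum_real (M : Matrix ι ι ℝ) : (spectrum ℝ M).Finite :=
  Matrix.finite_spectrum M

theorem lambdaMin_mul_le {M : Matrix ι ι ℝ} (hM : M.IsHermitian) (v : ι → ℝ) :
    lambdaMin M * (v ⬝ᵥ v) ≤ v ⬝ᵥ M *ᵥ v := by
  have hH : (M - algebraMap ℝ (Matrix ι ι ℝ) (lambdaMin M)).IsHermitian := by
    rw [Algebra.algebraMap_eq_smul_one]
    refine hM.sub ?_
    simp [Matrix.IsHermitian]
  have hP : (M - algebraMap ℝ (Matrix ι ι ℝ) (lambdaMin M)).PosSemidef := by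
    rw [hH.posSemidef_iff_eigenvalues_nonneg]
    intro i
    have hi : hH.eigenvalues i ∈ spectrum ℝ (M - algebraMap ℝ (Matrix ι ι ℝ) (lambdaMin M)) := by
      rw [hH.spectrum_real_eq_range_eigenvalues]
      exact ⟨i, rfl⟩
    rw [← spectrum.sub_singleton_eq] at hi
    obtain ⟨a, ha, b, rfl, hab⟩ := hi
    have := csInf_le (finite_spectrum_real M).bddBelow ha
    simp only [Pi.zero_apply, ← hab]
    exact sub_nonneg.2 this
  have := hP.dotProduct_mulVec_nonneg v
  rw [Algebra.algebraMap_eq_smul_one, Matrix.sub_mulVec, Matrix.smul_mulVec, Matrix.one_mulVec,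
    dotProduct_sub, dotProduct_smul, star_trivial, smul_eq_mul] at this
  linarith

theorem lambdaMax_eq (M : Matrix ι ι ℝ) : lambdaMax M = -lambdaMin (-M) := by
  unfold lambdaMax lambdaMin
  rw [← spectrum.neg_eq, Real.sInf_def, neg_neg, neg_neg]

theorem le_lambdaMax_mul {M : Matrix ι ι ℝ} (hM : M.IsHermitian) (v : ι → ℝ) :
    v ⬝ᵥ M *ᵥ v ≤ lambdaMax M * (v ⬝ᵥ v) := by
  have := lambdaMin_mul_le hM.neg v
  rw [Matrix.neg_mulVec, dotProduct_neg] at this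
  rw [lambdaMax_eq]
  linarith

theorem lambdaMin_mem [Nonempty ι] {M : Matrix ι ι ℝ} (hM : M.IsHermitian) :
    lambdaMin M ∈ spectrum ℝ M := by
  refine Set.Nonempty.csInf_mem ?_ (finite_spectrum_real M)
  rw [hM.spectrum_real_eq_range_eigenvalues]
  exact Set.range_nonempty _

theorem exists_mulVec_eq_lambdaMin [Nonempty ι] {M : Matrix ι ι ℝ} (hM : M.IsHermitian) :
    ∃ v : ι → ℝ, v ≠ 0 ∧ M *ᵥ v = lambdaMin M • v := by
  have h := lambdaMin_mem hM
  rw [← Matrix.spectrum_toLin', ← Module.End.hasEigenvalue_iff_mem_spectrum] at h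
  obtain ⟨v, hv⟩ := h.exists_hasEigenvector
  exact ⟨v, hv.2, by simpa using hv.apply_eq_smul⟩

theorem lambdaMin_pos [Nonempty ι] {M : Matrix ι ι ℝ} (hM : M.PosDef) : 0 < lambdaMin M := by
  obtain ⟨v, hv, h⟩ := exists_mulVec_eq_lambdaMin hM.isHermitian
  have h1 := hM.dotProduct_mulVec_pos hv
  rw [h, dotProduct_smul, star_trivial, smul_eq_mul] at h1
  exact pos_of_mul_pos_left h1 (dotProduct_self_nonneg_real v)

/-- The Rayleigh quotient of `S Sᵀ` controls `Sᵀ`, not `S`. Cauchy–Schwarz transfers the bound: with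
`Λ = λ_max(S Sᵀ)`, `‖Sv‖⁴ = ⟨v, Sᵀ S v⟩² ≤ ‖v‖² Λ ‖Sv‖²`, and one factor `‖Sv‖²` cancels. -/
theorem mulVec_dotProduct_le_lambdaMax (S : Matrix ι ι ℝ) (v : ι → ℝ) :
    (S *ᵥ v) ⬝ᵥ (S *ᵥ v) ≤ lambdaMax (S * Sᵀ) * (v ⬝ᵥ v) := by
  have hH : (S * Sᵀ).IsHermitian := by
    simp [Matrix.IsHermitian, Matrix.conjTranspose_eq_transpose_of_trivial]
  have h1 (u : ι → ℝ) : (Sᵀ *ᵥ u) ⬝ᵥ (Sᵀ *ᵥ u) ≤ lambdaMax (S * Sᵀ) * (u ⬝ᵥ u) := by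
    refine le_trans (le_of_eq ?_) (le_lambdaMax_mul hH u)
    rw [dotProduct_transpose_mulVec, Matrix.mulVec_mulVec]
  rcases (dotProduct_self_nonneg_real (S *ᵥ v)).eq_or_lt with h0 | h0
  · rw [← h0]
    exact (dotProduct_self_nonneg_real _).trans (h1 v)
  · have h2 := (dotProduct_transpose_mulVec S v (S *ᵥ v)).symm
    have h3 := dotProduct_sq_le v (Sᵀ *ᵥ (S *ᵥ v))
    rw [← h2] at h3
    have h4 := h3.trans (mul_le_mul_of_nonneg_left (h1 (S *ᵥ v)) (dotProduct_self_nonneg_real v))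
    nlinarith

end Rayleigh

/-! ### The residual bound for GMRES -/

section GMRES

variable {ι : Type*} [Fintype ι] [DecidableEq ι]

theorem krylov_mono (M : Matrix ι ι ℝ) (b : ι → ℝ) {m m' : ℕ} (h : m ≤ m') :
    krylov M b m ≤ krylov M b m' :=
  Submodule.span_mono fun _ ⟨j, hj, hv⟩ => ⟨j, hj.trans_le h, hv⟩

theorem mulVec_mem_krylov_succ {M : Matrix ι ι ℝ} {b y : ι → ℝ} {m : ℕ}
    (hy : y ∈ krylov M b m) : M *ᵥ y ∈ krylov M b (m + 1) := by
  have : krylov M b m ≤ (krylov M b (m + 1)).comap M.mulVecLin := by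
    refine Submodule.span_le.2 ?_
    rintro _ ⟨j, hj, rfl⟩
    refine Submodule.subset_span ⟨j + 1, by omega, ?_⟩
    rw [Matrix.mulVecLin_apply, Matrix.mulVec_mulVec, pow_succ']
  exact this hy

/-- The polynomial `(1 + ω t) ^ m` has value `1` at `0`, so it is an admissible residual polynomial:
`m` Richardson steps give a competitor for GMRES. -/
theorem exists_mem_krylov_pow (M : Matrix ι ι ℝ) (b : ι → ℝ) (ω : ℝ) (m : ℕ) :
    ∃ y ∈ krylov M b m, (1 + ω • M) ^ m *ᵥ b = b - M *ᵥ y := by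
  induction m with
  | zero => exact ⟨0, zero_mem _, by simp⟩
  | succ m ih =>
    obtain ⟨y, hy, h⟩ := ih
    have hb : b ∈ krylov M b (m + 1) := Submodule.subset_span ⟨0, by omega, by simp⟩
    refine ⟨y - ω • b + ω • (M *ᵥ y), add_mem (sub_mem (krylov_mono M b m.le_succ hy)
      (Submodule.smul_mem _ _ hb)) (Submodule.smul_mem _ _ (mulVec_mem_krylov_succ hy)), ?_⟩
    rw [pow_succ', ← Matrix.mulVec_mulVec, h]
    simp only [Matrix.add_mulVec, Matrix.one_mulVec, Matrix.smul_mulVec, Matrix.mulVec_sub,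
      Matrix.mulVec_add, Matrix.mulVec_smul]
    abel

theorem IsGMRESIterate.le_pow {M : Matrix ι ι ℝ} {b x : ι → ℝ} {m : ℕ}
    (h : IsGMRESIterate M b m x) (ω : ℝ) :
    (b - M *ᵥ x) ⬝ᵥ (b - M *ᵥ x) ≤
      ((1 + ω • M) ^ m *ᵥ b) ⬝ᵥ ((1 + ω • M) ^ m *ᵥ b) := by
  obtain ⟨y, hy, he⟩ := exists_mem_krylov_pow M b ω m
  have := h.2 y hy
  rw [vecNorm_eq, vecNorm_eq] at this
  rw [he]
  exact (Real.sqrt_le_sqrt_iff (dotProduct_self_nonneg_real _)).1 this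

/-- The contraction factor of Elman's residual bound. -/
noncomputable def elmanFactor (S : Matrix ι ι ℝ) : ℝ :=
  1 - lambdaMin (-((1 / 2 : ℝ) • (S + Sᵀ))) ^ 2 / lambdaMax (S * Sᵀ)

theorem dotProduct_mulVec_le_neg_lambdaMin (S : Matrix ι ι ℝ) (v : ι → ℝ) :
    v ⬝ᵥ S *ᵥ v ≤ -lambdaMin (-((1 / 2 : ℝ) • (S + Sᵀ))) * (v ⬝ᵥ v) := by
  have hH : (-((1 / 2 : ℝ) • (S + Sᵀ))).IsHermitian := by
    simp [Matrix.IsHermitian, Matrix.conjTranspose_eq_transpose_of_trivial, add_comm]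
  have := lambdaMin_mul_le hH v
  rw [Matrix.neg_mulVec, Matrix.smul_mulVec, Matrix.add_mulVec, dotProduct_neg, dotProduct_smul,
    dotProduct_add, dotProduct_transpose_mulVec, smul_eq_mul] at this
  linarith

theorem lambdaMax_mul_transpose_pos [Nonempty ι] {S : Matrix ι ι ℝ}
    (hS : 0 < lambdaMin (-((1 / 2 : ℝ) • (S + Sᵀ)))) : 0 < lambdaMax (S * Sᵀ) := by
  obtain ⟨v, hv⟩ := exists_ne (0 : ι → ℝ)
  have hv' := dotProduct_self_pos_of_ne_zero hv
  have h1 := dotProduct_mulVec_le_neg_lambdaMin S v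
  have h2 := mulVec_dotProduct_le_lambdaMax S v
  have h3 : S *ᵥ v ≠ 0 := by
    intro h0
    rw [h0, dotProduct_zero] at h1
    nlinarith
  exact pos_of_mul_pos_left ((dotProduct_self_pos_of_ne_zero h3).trans_le h2) hv'.le

theorem elmanFactor_lt_one [Nonempty ι] {S : Matrix ι ι ℝ}
    (hS : 0 < lambdaMin (-((1 / 2 : ℝ) • (S + Sᵀ)))) : elmanFactor S < 1 := by
  have := div_pos (pow_pos hS 2) (lambdaMax_mul_transpose_pos hS)
  rw [elmanFactor]
  linarith

/-- With `μ` and `Λ` the two extreme eigenvalues, the expanded square is at most `(1 - 2ωμ + ω²Λ)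
‖v‖²`; `ω = μ / Λ` minimizes this and yields `1 - μ² / Λ`. The factor contracts squared norms. -/
theorem elman_step [Nonempty ι] {S : Matrix ι ι ℝ}
    (hS : 0 < lambdaMin (-((1 / 2 : ℝ) • (S + Sᵀ)))) (v : ι → ℝ) :
    let ω := lambdaMin (-((1 / 2 : ℝ) • (S + Sᵀ))) / lambdaMax (S * Sᵀ)
    ((1 + ω • S) *ᵥ v) ⬝ᵥ ((1 + ω • S) *ᵥ v) ≤ elmanFactor S * (v ⬝ᵥ v) := by
  intro ω
  have hΛ := lambdaMax_mul_transpose_pos hS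
  have h1 := dotProduct_mulVec_le_neg_lambdaMin S v
  have h2 := mulVec_dotProduct_le_lambdaMax S v
  have hω : 0 < ω := div_pos hS hΛ
  have hωΛ : ω * lambdaMax (S * Sᵀ) = lambdaMin (-((1 / 2 : ℝ) • (S + Sᵀ))) :=
    div_mul_cancel₀ _ hΛ.ne'
  have hE : elmanFactor S = 1 - ω * lambdaMin (-((1 / 2 : ℝ) • (S + Sᵀ))) := by
    simp only [elmanFactor, ω]; ring
  rw [hE]
  simp only [Matrix.add_mulVec, Matrix.one_mulVec, Matrix.smul_mulVec, add_dotProduct,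
    dotProduct_add, smul_dotProduct, dotProduct_smul, smul_eq_mul]
  rw [dotProduct_comm (S *ᵥ v) v]
  generalize lambdaMin (-((1 / 2 : ℝ) • (S + Sᵀ))) = μ at *
  have h3 := mul_le_mul_of_nonneg_left h1 hω.le
  have h4 := mul_le_mul_of_nonneg_left h2 (mul_pos hω hω).le
  have h5 : ω * ω * (lambdaMax (S * Sᵀ) * (v ⬝ᵥ v)) = ω * μ * (v ⬝ᵥ v) := by
    rw [← hωΛ]; ring
  linarith

theorem elmanFactor_nonneg [Nonempty ι] {S : Matrix ι ι ℝ}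
    (hS : 0 < lambdaMin (-((1 / 2 : ℝ) • (S + Sᵀ)))) : 0 ≤ elmanFactor S := by
  obtain ⟨v, hv⟩ := exists_ne (0 : ι → ℝ)
  exact nonneg_of_mul_nonneg_left ((dotProduct_self_nonneg_real _).trans (elman_step hS v))
    (dotProduct_self_pos_of_ne_zero hv)

theorem elman_pow [Nonempty ι] {S : Matrix ι ι ℝ}
    (hS : 0 < lambdaMin (-((1 / 2 : ℝ) • (S + Sᵀ)))) (v : ι → ℝ) (m : ℕ) :
    let ω := lambdaMin (-((1 / 2 : ℝ) • (S + Sᵀ))) / lambdaMax (S * Sᵀ)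
    ((1 + ω • S) ^ m *ᵥ v) ⬝ᵥ ((1 + ω • S) ^ m *ᵥ v) ≤ elmanFactor S ^ m * (v ⬝ᵥ v) := by
  intro ω
  induction m with
  | zero => simp
  | succ m ih =>
    rw [pow_succ', ← Matrix.mulVec_mulVec, pow_succ', mul_assoc]
    exact (elman_step hS _).trans (mul_le_mul_of_nonneg_left ih (elmanFactor_nonneg hS))

theorem pow_mulVec_intertwine {T M S : Matrix ι ι ℝ} (h : T * M = S * T) (ω : ℝ) (m : ℕ) :
    T * (1 + ω • M) ^ m = (1 + ω • S) ^ m * T := by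
  have h1 : SemiconjBy T (1 + ω • M) (1 + ω • S) := by
    simp [SemiconjBy, mul_add, add_mul, h]
  exact (h1.pow_right m).eq

/-- Elman's bound for GMRES, transported along a similarity transformation `T`. -/
theorem IsGMRESIterate.residual_le [Nonempty ι] {T M S : Matrix ι ι ℝ} {b x : ι → ℝ} {m : ℕ}
    (h : IsGMRESIterate M b m x) (hTM : T * M = S * T)
    (hS : 0 < lambdaMin (-((1 / 2 : ℝ) • (S + Sᵀ)))) {c d : ℝ} (hd : 0 ≤ d)
    (hT : ∀ v, (T *ᵥ v) ⬝ᵥ (T *ᵥ v) ≤ c * (v ⬝ᵥ v))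
    (hT' : ∀ v, v ⬝ᵥ v ≤ d * ((T *ᵥ v) ⬝ᵥ (T *ᵥ v))) :
    (b - M *ᵥ x) ⬝ᵥ (b - M *ᵥ x) ≤ d * c * elmanFactor S ^ m * (b ⬝ᵥ b) := by
  -- GMRES minimizes in the untransformed norm, so the competitor is a power of `1 + ω • M`. Moving
  -- `T` past it replaces `M` by `S`, where Elman's step applies.
  set ω := lambdaMin (-((1 / 2 : ℝ) • (S + Sᵀ))) / lambdaMax (S * Sᵀ)
  refine (h.le_pow ω).trans ((hT' _).trans ?_)
  rw [Matrix.mulVec_mulVec, pow_mulVec_intertwine hTM, ← Matrix.mulVec_mulVec, mul_assoc, mul_assoc]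
  refine mul_le_mul_of_nonneg_left ((elman_pow hS _ m).trans ?_) hd
  rw [mul_left_comm]
  exact mul_le_mul_of_nonneg_left (hT b) (pow_nonneg (elmanFactor_nonneg hS) m)

end GMRES

variable {n : ℕ}

/-! ### Matrices with negative numerical range -/

/-- The quadratic form of `N` is negative definite (`N` need not be symmetric). -/
def NegForm (N : Matrix (Fin n) (Fin n) ℝ) : Prop :=
  ∀ v : Fin n → ℝ, v ≠ 0 → v ⬝ᵥ N *ᵥ v < 0

theorem NegForm.le_zero {N : Matrix (Fin n) (Fin n) ℝ} (hN : NegForm N) (v : Fin n → ℝ) :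
    v ⬝ᵥ N *ᵥ v ≤ 0 := by
  rcases eq_or_ne v 0 with rfl | hv
  · simp
  · exact (hN v hv).le

theorem re_star_dotProduct_map_mulVec (N : Matrix (Fin n) (Fin n) ℝ) (z : Fin n → ℂ) :
    (star z ⬝ᵥ (N.map Complex.ofReal *ᵥ z)).re =
      (fun i => (z i).re) ⬝ᵥ N *ᵥ (fun i => (z i).re) +
        (fun i => (z i).im) ⬝ᵥ N *ᵥ (fun i => (z i).im) := by
  simp [dotProduct, Matrix.mulVec, Complex.re_sum, Complex.im_sum, Finset.sum_add_distrib]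

theorem negForm_of_numericalRange {N : Matrix (Fin n) (Fin n) ℝ}
    (h : ∀ z ∈ numericalRange N, z.re < 0) : NegForm N := by
  intro v hv
  have hv' := dotProduct_self_pos_of_ne_zero hv
  set c := Real.sqrt (v ⬝ᵥ v)
  have hc : 0 < c := Real.sqrt_pos.2 hv'
  have hcc : c * c = v ⬝ᵥ v := Real.mul_self_sqrt hv'.le
  have h1 := h _ ⟨WithLp.toLp 2 (fun i => ((c⁻¹ * v i : ℝ) : ℂ)), ?_, rfl⟩
  · rw [re_star_dotProduct_map_mulVec] at h1
    have e : (fun i => c⁻¹ * v i) = c⁻¹ • v := rfl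
    have e0 : (fun _ : Fin n => (0 : ℝ)) = 0 := rfl
    simp only [Complex.ofReal_re, Complex.ofReal_im, e, e0, zero_dotProduct, add_zero,
      Matrix.mulVec_smul, smul_dotProduct, dotProduct_smul, smul_eq_mul, ← mul_assoc] at h1
    exact (pos_iff_neg_of_mul_neg h1).1 (by positivity)
  · rw [EuclideanSpace.norm_eq, Real.sqrt_eq_one]
    simp only [Complex.norm_real, Real.norm_eq_abs, sq_abs, mul_pow, ← Finset.mul_sum]
    have : ∑ i, v i ^ 2 = c * c := by rw [hcc]; simp [dotProduct, pow_two]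
    rw [this]
    field_simp

theorem exists_mulVec_eq_of_mem_spectrum {N : Matrix (Fin n) (Fin n) ℂ} {μ : ℂ}
    (h : μ ∈ spectrum ℂ N) : ∃ z : Fin n → ℂ, z ≠ 0 ∧ N *ᵥ z = μ • z := by
  rw [← Matrix.spectrum_toLin', ← Module.End.hasEigenvalue_iff_mem_spectrum] at h
  obtain ⟨v, hv⟩ := h.exists_hasEigenvector
  exact ⟨v, hv.2, by simpa using hv.apply_eq_smul⟩

/-- For an eigenvector `z = x + iy`, the real part of `zᴴ N z = μ ‖z‖²` is the sum of the real forms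
at `x` and `y`, one of which is nonzero. -/
theorem NegForm.isStable {N : Matrix (Fin n) (Fin n) ℝ} (hN : NegForm N) : IsStable N := by
  intro μ hμ
  obtain ⟨z, hz, he⟩ := exists_mulVec_eq_of_mem_spectrum hμ
  have h1 := re_star_dotProduct_map_mulVec N z
  have h2 : (star z ⬝ᵥ z).re = (fun i => (z i).re) ⬝ᵥ (fun i => (z i).re) +
      (fun i => (z i).im) ⬝ᵥ (fun i => (z i).im) := by
    simpa using re_star_dotProduct_map_mulVec 1 z
  have h3 : (star z ⬝ᵥ z).im = 0 := by
    simp [dotProduct, Complex.im_sum, mul_comm]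
  rw [he, dotProduct_smul, smul_eq_mul, Complex.mul_re, h3, mul_zero, sub_zero, h2] at h1
  have hne : (fun i => (z i).re) ≠ 0 ∨ (fun i => (z i).im) ≠ 0 := by
    by_contra! hcon
    exact hz (funext fun i => Complex.ext (congrFun hcon.1 i) (congrFun hcon.2 i))
  have p1 := dotProduct_self_nonneg_real (fun i => (z i).re)
  have p2 := dotProduct_self_nonneg_real (fun i => (z i).im)
  have q1 := hN.le_zero (fun i => (z i).re)
  have q2 := hN.le_zero (fun i => (z i).im)
  by_contra! hμ0
  rcases hne with h | h
  · nlinarith [hN _ h, mul_nonneg hμ0 (add_nonneg p1 p2)]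
  · nlinarith [hN _ h, mul_nonneg hμ0 (add_nonneg p1 p2)]

theorem NegForm.isStable_of_conj {M L : Matrix (Fin n) (Fin n) ℝ} (hL : IsUnit L.det)
    (h : NegForm (L⁻¹ * M * L)) : IsStable M := by
  intro μ hμ
  refine h.isStable μ ?_
  rw [Matrix.mem_spectrum_iff_isRoot_charpoly] at hμ ⊢
  have e : (L⁻¹ * M * L).charpoly = M.charpoly := by
    rw [Matrix.charpoly_mul_comm, ← mul_assoc, Matrix.mul_nonsing_inv _ hL, one_mul]
  rw [show (Complex.ofReal : ℝ → ℂ) = Complex.ofRealHom from rfl, Matrix.charpoly_map] at hμ ⊢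
  rwa [e]

/-- A Sylvester equation with a stable and a weakly stable coefficient has only the zero
solution. -/
theorem eq_zero_of_sylvester {M N D : Matrix (Fin n) (Fin n) ℝ} (hM : IsStable M)
    (hN : IsWeaklyStable N) (h : Mᵀ * D + D * N = 0) : D = 0 := by
  rcases isEmpty_or_nonempty (Fin n) with hn | hn
  · exact Subsingleton.elim _ _
  set φ := Complex.ofRealHom.mapMatrix (m := Fin n)
  have hφ (P : Matrix (Fin n) (Fin n) ℝ) : φ P = P.map Complex.ofReal := rfl
  set p := (φ N).charpoly
  -- `D` intertwines `N` with `-Mᵀ`. For the characteristic polynomial `p` of `N`, Cayley–Hamilton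
  -- gives `p(-Mᵀ) D = D p(N) = 0`. Since the spectra of `N` and `-Mᵀ` are disjoint, `p(-Mᵀ)` is
  -- invertible.
  have hsemi : SemiconjBy (φ D) (φ N) (-(φ M)ᵀ) := by
    have h1 : φ Mᵀ * φ D + φ D * φ N = 0 := by rw [← map_mul, ← map_mul, ← map_add, h, map_zero]
    have h2 : φ Mᵀ = (φ M)ᵀ := rfl
    rw [SemiconjBy, neg_mul, ← h2]
    exact eq_neg_of_add_eq_zero_right h1
  have haeval : ∀ q : Polynomial ℂ,
      φ D * Polynomial.aeval (φ N) q = Polynomial.aeval (-(φ M)ᵀ) q * φ D := by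
    intro q
    induction q using Polynomial.induction_on' with
    | add a b ha hb => rw [map_add, map_add, mul_add, add_mul, ha, hb]
    | monomial k a =>
      rw [Polynomial.aeval_monomial, Polynomial.aeval_monomial, ← mul_assoc,
        ← Algebra.commutes a (φ D), mul_assoc, mul_assoc, (hsemi.pow_right k).eq]
  have h0 := haeval p
  rw [Matrix.aeval_self_charpoly, mul_zero] at h0
  have hunit : IsUnit (Polynomial.aeval (-(φ M)ᵀ) p) := by
    by_contra hcon
    rw [← spectrum.zero_mem_iff ℂ, spectrum.map_polynomial_aeval_of_nonempty] at hcon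
    · obtain ⟨μ, hμ, hr⟩ := hcon
      have hN' := hN μ (by rw [Matrix.mem_spectrum_iff_isRoot_charpoly]; exact hr)
      have hM' := hM (-μ) (by
        rw [← spectrum.neg_eq, Set.mem_neg, Matrix.mem_spectrum_iff_isRoot_charpoly,
          Matrix.charpoly_transpose, ← Matrix.mem_spectrum_iff_isRoot_charpoly] at hμ
        exact hμ)
      rw [Complex.neg_re] at hM'
      linarith
    · exact spectrum.nonempty_of_isAlgClosed_of_finiteDimensional ℂ _
  have h2 : φ D = 0 := (hunit.mul_right_eq_zero).1 h0.symm
  ext i j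
  simpa [hφ] using congrFun (congrFun h2 i) j

/-! ### The Lyapunov matrix -/

theorem lyapMatrix_mulVec_vec (M Z : Matrix (Fin n) (Fin n) ℝ) :
    lyapMatrix M *ᵥ Matrix.vec Z = Matrix.vec (Mᵀ * Z + Z * M) := by
  rw [lyapMatrix, Matrix.add_mulVec, Matrix.kronecker_mulVec_vec, Matrix.kronecker_mulVec_vec]
  simp

/-- The Lyapunov operator preserves symmetry, hence so does every Krylov vector built from a
symmetric right-hand side. -/
theorem isSymm_of_vec_mem_krylov {M B Z : Matrix (Fin n) (Fin n) ℝ} (hB : B.IsSymm) {m : ℕ}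
    (h : Matrix.vec Z ∈ krylov (lyapMatrix M) (Matrix.vec B) m) : Z.IsSymm := by
  let W : Submodule ℝ (Fin n × Fin n → ℝ) :=
    { carrier := {v | v ∘ Prod.swap = v}
      add_mem' := fun {a b} ha hb => by
        rw [Set.mem_ofPred_eq] at *; rw [Pi.add_comp, ha, hb]
      zero_mem' := rfl
      smul_mem' := fun c a ha => by
        rw [Set.mem_ofPred_eq] at *; rw [Pi.smul_comp, ha] }
  have hpow (j : ℕ) : ∃ P : Matrix (Fin n) (Fin n) ℝ, P.IsSymm ∧
      (lyapMatrix M ^ j) *ᵥ Matrix.vec B = Matrix.vec P := by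
    induction j with
    | zero => exact ⟨B, hB, by simp⟩
    | succ j ih =>
      obtain ⟨P, hP, he⟩ := ih
      refine ⟨Mᵀ * P + P * M, ?_, ?_⟩
      · simp [Matrix.IsSymm, hP.eq, add_comm]
      · rw [pow_succ', ← Matrix.mulVec_mulVec, he, lyapMatrix_mulVec_vec]
  have hle : krylov (lyapMatrix M) (Matrix.vec B) m ≤ W := by
    refine Submodule.span_le.2 ?_
    rintro _ ⟨j, -, rfl⟩
    obtain ⟨P, hP, he⟩ := hpow j
    change (lyapMatrix M ^ j *ᵥ B.vec) ∘ Prod.swap = lyapMatrix M ^ j *ᵥ B.vec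
    rw [he, ← Matrix.vec_transpose, hP.eq]
  have := hle h
  change Z.vec ∘ Prod.swap = Z.vec at this
  rwa [← Matrix.vec_transpose, Matrix.vec_inj] at this

theorem scaledLyapMatrix_eq {L : Matrix (Fin n) (Fin n) ℝ} (hL : IsUnit L.det)
    (M : Matrix (Fin n) (Fin n) ℝ) : scaledLyapMatrix L M = lyapMatrix (L⁻¹ * M * L) := by
  have h : Lᵀ * (L⁻¹)ᵀ = 1 := by
    rw [← Matrix.transpose_mul, Matrix.nonsing_inv_mul _ hL, Matrix.transpose_one]
  simp only [scaledLyapMatrix, lyapMatrix, mul_add, add_mul, ← Matrix.mul_kronecker_mul,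
    Matrix.transpose_mul, mul_one, h, mul_assoc]

theorem scaledLyapMatrix_mul {L : Matrix (Fin n) (Fin n) ℝ} (hL : IsUnit L.det)
    (M : Matrix (Fin n) (Fin n) ℝ) :
    (Lᵀ ⊗ₖ Lᵀ) * lyapMatrix M = scaledLyapMatrix L M * (Lᵀ ⊗ₖ Lᵀ) := by
  have h : (L⁻¹)ᵀ * Lᵀ = 1 := by
    rw [← Matrix.transpose_mul, Matrix.mul_nonsing_inv _ hL, Matrix.transpose_one]
  rw [scaledLyapMatrix, mul_assoc _ _ (Lᵀ ⊗ₖ Lᵀ), ← Matrix.mul_kronecker_mul, h,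
    Matrix.one_kronecker_one, mul_one]

theorem NegForm.posDef_neg_symmPart {N : Matrix (Fin n) (Fin n) ℝ} (hN : NegForm N) :
    (-((1 / 2 : ℝ) • (N + Nᵀ))).PosDef := by
  refine .of_dotProduct_mulVec_pos ?_ fun v hv => ?_
  · simp [Matrix.IsHermitian, Matrix.conjTranspose_eq_transpose_of_trivial, add_comm]
  · have := hN v hv
    rw [star_trivial, Matrix.neg_mulVec, Matrix.smul_mulVec, Matrix.add_mulVec, dotProduct_neg,
      dotProduct_smul, dotProduct_add, dotProduct_transpose_mulVec, smul_eq_mul]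
    linarith

/-- The negated symmetric part is the Kronecker sum `1 ⊗ H + H ⊗ 1`, where `H` is the negated
symmetric part of `N`. -/
theorem NegForm.posDef_neg_symmPart_lyapMatrix {N : Matrix (Fin n) (Fin n) ℝ} (hN : NegForm N) :
    (-((1 / 2 : ℝ) • (lyapMatrix N + (lyapMatrix N)ᵀ))).PosDef := by
  have hH := hN.posDef_neg_symmPart
  have h1 : (1 : Matrix (Fin n) (Fin n) ℝ).PosDef := .one
  have e : -((1 / 2 : ℝ) • (lyapMatrix N + (lyapMatrix N)ᵀ)) =
      1 ⊗ₖ (-((1 / 2 : ℝ) • (N + Nᵀ))) + (-((1 / 2 : ℝ) • (N + Nᵀ))) ⊗ₖ 1 := by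
    ext ⟨i, j⟩ ⟨k, l⟩
    simp only [lyapMatrix, Matrix.neg_apply, Matrix.smul_apply, Matrix.add_apply,
      Matrix.transpose_apply, Matrix.kronecker_apply, Matrix.one_apply, smul_eq_mul,
      eq_comm (a := k), eq_comm (a := l)]
    split_ifs <;> ring
  rw [e]
  exact (h1.kronecker hH).add (hH.kronecker h1)

/-- If `N` has negative definite form and `NᵀY + YN` is negative semidefinite, then `Y` is positive
semidefinite. -/
theorem NegForm.posSemidef_of_lyapunov {N Y : Matrix (Fin n) (Fin n) ℝ} (hN : NegForm N)
    (hY : Y.IsSymm) (h : ∀ v, v ⬝ᵥ (Nᵀ * Y + Y * N) *ᵥ v ≤ 0) : Y.PosSemidef := by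
  rcases isEmpty_or_nonempty (Fin n) with hn | hn
  · rw [Subsingleton.elim Y 0]
    exact .zero
  have hH : Y.IsHermitian := by
    rw [Matrix.IsHermitian, Matrix.conjTranspose_eq_transpose_of_trivial, hY.eq]
  -- At an eigenvector for the smallest eigenvalue `λ` of `Y`, the Lyapunov form equals `2 λ ⟨v, N
  -- v⟩`. It is nonpositive while `⟨v, N v⟩ < 0`, so `λ ≥ 0`.
  obtain ⟨v, hv, he⟩ := exists_mulVec_eq_lambdaMin hH
  have h1 := h v
  rw [Matrix.add_mulVec, ← Matrix.mulVec_mulVec, ← Matrix.mulVec_mulVec, dotProduct_add,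
    dotProduct_transpose_mulVec, ← dotProduct_transpose_mulVec Y, hY.eq, he,
    smul_dotProduct, dotProduct_comm (N *ᵥ v), smul_dotProduct,
    smul_eq_mul] at h1
  have h2 := hN v hv
  have h3 : 0 ≤ lambdaMin Y := by nlinarith
  refine .of_dotProduct_mulVec_nonneg hH fun w => ?_
  rw [star_trivial]
  exact (mul_nonneg h3 (dotProduct_self_nonneg_real w)).trans (lambdaMin_mul_le hH w)

/-! ### Norm estimates -/

theorem frobNorm_eq (M : Matrix (Fin n) (Fin n) ℝ) :
    frobNorm M = Real.sqrt (Matrix.vec M ⬝ᵥ Matrix.vec M) := by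
  rw [frobNorm, Finset.sum_comm]
  simp [dotProduct, Matrix.vec, Fintype.sum_prod_type, pow_two]

theorem frobNorm_sq (M : Matrix (Fin n) (Fin n) ℝ) :
    frobNorm M ^ 2 = Matrix.vec M ⬝ᵥ Matrix.vec M := by
  rw [frobNorm_eq, Real.sq_sqrt (dotProduct_self_nonneg_real _)]

theorem mulVec_dotProduct_le_specNorm (M : Matrix (Fin n) (Fin n) ℝ) (v : Fin n → ℝ) :
    (M *ᵥ v) ⬝ᵥ (M *ᵥ v) ≤ specNorm M ^ 2 * (v ⬝ᵥ v) := by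
  have h := (Matrix.toEuclideanCLM (n := Fin n) (𝕜 := ℝ) M).le_opNorm (WithLp.toLp 2 v)
  have h2 := pow_le_pow_left₀ (norm_nonneg _) h 2
  rw [mul_pow, EuclideanSpace.real_norm_sq_eq, EuclideanSpace.real_norm_sq_eq] at h2
  simpa [dotProduct, specNorm, pow_two] using h2

theorem vec_dotProduct_vec_eq_sum (M : Matrix (Fin n) (Fin n) ℝ) :
    Matrix.vec M ⬝ᵥ Matrix.vec M = ∑ j, M.col j ⬝ᵥ M.col j := by
  simp [dotProduct, Matrix.vec, Fintype.sum_prod_type]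

theorem vec_transpose_dotProduct_vec_transpose (M : Matrix (Fin n) (Fin n) ℝ) :
    Matrix.vec Mᵀ ⬝ᵥ Matrix.vec Mᵀ = Matrix.vec M ⬝ᵥ Matrix.vec M := by
  rw [Matrix.vec_dotProduct_vec, Matrix.vec_dotProduct_vec, Matrix.trace_mul_comm,
    Matrix.transpose_transpose]

theorem vec_mul_dotProduct_le (M N : Matrix (Fin n) (Fin n) ℝ) :
    Matrix.vec (M * N) ⬝ᵥ Matrix.vec (M * N) ≤
      specNorm M ^ 2 * (Matrix.vec N ⬝ᵥ Matrix.vec N) := by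
  rw [vec_dotProduct_vec_eq_sum, vec_dotProduct_vec_eq_sum, Finset.mul_sum]
  exact Finset.sum_le_sum fun j _ => mulVec_dotProduct_le_specNorm M (N.col j)

theorem vec_congr_dotProduct_le (K Z : Matrix (Fin n) (Fin n) ℝ) :
    Matrix.vec (K * Z * Kᵀ) ⬝ᵥ Matrix.vec (K * Z * Kᵀ) ≤
      (specNorm K ^ 2) ^ 2 * (Matrix.vec Z ⬝ᵥ Matrix.vec Z) := by
  rw [mul_assoc, pow_two (specNorm K ^ 2), mul_assoc]
  refine (vec_mul_dotProduct_le _ _).trans (mul_le_mul_of_nonneg_left ?_ (by positivity))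
  rw [← vec_transpose_dotProduct_vec_transpose, Matrix.transpose_mul, Matrix.transpose_transpose,
    ← vec_transpose_dotProduct_vec_transpose Z]
  exact vec_mul_dotProduct_le _ _

/-- The C*-identity; with `K = Lᵀ` and `K = L⁻ᵀ` it turns the distortion of the congruence by `L`
into `‖F‖₂` and `‖F⁻¹‖₂`, hence `κ(F)`. -/
theorem specNorm_transpose_mul_self (K : Matrix (Fin n) (Fin n) ℝ) :
    specNorm (Kᵀ * K) = specNorm K ^ 2 := by
  rw [specNorm, specNorm, ← Matrix.conjTranspose_eq_transpose_of_trivial,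
    ← Matrix.star_eq_conjTranspose, map_mul, map_star, pow_two,
    ContinuousLinearMap.star_eq_adjoint]
  exact ContinuousLinearMap.norm_adjoint_comp_self _

theorem abs_le_specNorm (M : Matrix (Fin n) (Fin n) ℝ) (i j : Fin n) : |M i j| ≤ specNorm M := by
  have h := mulVec_dotProduct_le_specNorm M (Pi.single j 1)
  rw [Matrix.mulVec_single_one, dotProduct_single, Pi.single_eq_same, mul_one, mul_one] at h
  refine abs_le_of_sq_le_sq (le_trans ?_ h) (norm_nonneg _)
  simpa [dotProduct, pow_two] using
    Finset.single_le_sum (f := fun k => M k j * M k j) (fun k _ => mul_self_nonneg _)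
      (Finset.mem_univ i)

theorem sq_dotProduct_mulVec_le (M : Matrix (Fin n) (Fin n) ℝ) (v : Fin n → ℝ) :
    (v ⬝ᵥ M *ᵥ v) ^ 2 ≤ (Matrix.vec M ⬝ᵥ Matrix.vec M) * (v ⬝ᵥ v) ^ 2 := by
  have h : (M *ᵥ v) ⬝ᵥ (M *ᵥ v) ≤ (Matrix.vec M ⬝ᵥ Matrix.vec M) * (v ⬝ᵥ v) := by
    rw [← vec_transpose_dotProduct_vec_transpose, vec_dotProduct_vec_eq_sum, Finset.sum_mul]
    refine Finset.sum_le_sum fun i _ => ?_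
    have := dotProduct_sq_le (M i) v
    rw [pow_two] at this
    exact this
  refine (dotProduct_sq_le _ _).trans ?_
  have := mul_le_mul_of_nonneg_left h (dotProduct_self_nonneg_real v)
  linarith

theorem specNorm_transpose (K : Matrix (Fin n) (Fin n) ℝ) : specNorm Kᵀ = specNorm K := by
  rw [specNorm, specNorm, ← Matrix.conjTranspose_eq_transpose_of_trivial,
    ← Matrix.star_eq_conjTranspose, map_star, ContinuousLinearMap.star_eq_adjoint]
  exact LinearIsometryEquiv.norm_map _ _

theorem isSymm_of_isHermitian {Z : Matrix (Fin n) (Fin n) ℝ} (hZ : Z.IsHermitian) : Z.IsSymm := by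
  rwa [Matrix.IsHermitian, Matrix.conjTranspose_eq_transpose_of_trivial] at hZ

/-! ### The Cholesky change of variables -/

theorem IsCholeskyFactor.isUnit_det {F L : Matrix (Fin n) (Fin n) ℝ} (hL : IsCholeskyFactor F L)
    (hF : F.PosDef) : IsUnit L.det := by
  have h := hF.isUnit
  rw [Matrix.isUnit_iff_isUnit_det, hL.eq, Matrix.det_mul] at h
  exact isUnit_of_mul_isUnit_left h

theorem kronecker_mulVec_vec_eq (L Z : Matrix (Fin n) (Fin n) ℝ) :
    (Lᵀ ⊗ₖ Lᵀ) *ᵥ Matrix.vec Z = Matrix.vec (Lᵀ * Z * L) := by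
  rw [Matrix.kronecker_mulVec_vec, Matrix.transpose_transpose]

theorem congr_cancel {L : Matrix (Fin n) (Fin n) ℝ} (hL : IsUnit L.det)
    (Z : Matrix (Fin n) (Fin n) ℝ) : (L⁻¹)ᵀ * (Lᵀ * Z * L) * ((L⁻¹)ᵀ)ᵀ = Z := by
  have h : (L⁻¹)ᵀ * Lᵀ = 1 := by
    rw [← Matrix.transpose_mul, Matrix.mul_nonsing_inv _ hL, Matrix.transpose_one]
  calc _ = ((L⁻¹)ᵀ * Lᵀ) * Z * (L * L⁻¹) := by
        rw [Matrix.transpose_transpose]; simp only [mul_assoc]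
    _ = Z := by rw [h, Matrix.mul_nonsing_inv _ hL, one_mul, mul_one]

theorem IsCholeskyFactor.vec_congr_le {F L : Matrix (Fin n) (Fin n) ℝ}
    (hL : IsCholeskyFactor F L) (Z : Matrix (Fin n) (Fin n) ℝ) :
    Matrix.vec (Lᵀ * Z * L) ⬝ᵥ Matrix.vec (Lᵀ * Z * L) ≤
      specNorm F ^ 2 * (Matrix.vec Z ⬝ᵥ Matrix.vec Z) := by
  have h := vec_congr_dotProduct_le Lᵀ Z
  rwa [← specNorm_transpose_mul_self, Matrix.transpose_transpose, ← hL.eq] at h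

theorem IsCholeskyFactor.vec_le_congr {F L : Matrix (Fin n) (Fin n) ℝ}
    (hL : IsCholeskyFactor F L) (hF : F.PosDef) (Z : Matrix (Fin n) (Fin n) ℝ) :
    Matrix.vec Z ⬝ᵥ Matrix.vec Z ≤
      specNorm F⁻¹ ^ 2 * (Matrix.vec (Lᵀ * Z * L) ⬝ᵥ Matrix.vec (Lᵀ * Z * L)) := by
  have h := vec_congr_dotProduct_le (L⁻¹)ᵀ (Lᵀ * Z * L)
  rw [congr_cancel (hL.isUnit_det hF), specNorm_transpose, ← specNorm_transpose_mul_self,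
    Matrix.transpose_nonsing_inv, ← Matrix.mul_inv_rev, ← hL.eq] at h
  exact h

theorem IsCholeskyFactor.conj_closedLoop {F L : Matrix (Fin n) (Fin n) ℝ}
    (hL : IsCholeskyFactor F L) (hF : F.PosDef) (A X : Matrix (Fin n) (Fin n) ℝ) :
    L⁻¹ * (A - F * X) * L = L⁻¹ * A * L - Lᵀ * X * L := by
  have h : L⁻¹ * F = Lᵀ := by
    conv_lhs => rw [hL.eq, ← mul_assoc, Matrix.nonsing_inv_mul _ (hL.isUnit_det hF), one_mul]
  rw [mul_sub, sub_mul, ← mul_assoc L⁻¹ F X, h]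

theorem posSemidef_congr (L : Matrix (Fin n) (Fin n) ℝ) {X : Matrix (Fin n) (Fin n) ℝ}
    (hX : X.PosSemidef) : (Lᵀ * X * L).PosSemidef := by
  simpa [Matrix.conjTranspose_eq_transpose_of_trivial] using hX.conjTranspose_mul_mul_same L

theorem IsCholeskyFactor.negForm_closedLoop {F L A X : Matrix (Fin n) (Fin n) ℝ}
    (hL : IsCholeskyFactor F L) (hF : F.PosDef) (hA : NegForm (L⁻¹ * A * L))
    (hX : X.PosSemidef) : NegForm (L⁻¹ * (A - F * X) * L) := by
  intro v hv
  have h1 := (posSemidef_congr L hX).dotProduct_mulVec_nonneg v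
  rw [star_trivial] at h1
  rw [hL.conj_closedLoop hF, Matrix.sub_mulVec, dotProduct_sub]
  linarith [hA v hv]

theorem IsCholeskyFactor.isStable_closedLoop {F L A X : Matrix (Fin n) (Fin n) ℝ}
    (hL : IsCholeskyFactor F L) (hF : F.PosDef) (hA : NegForm (L⁻¹ * A * L))
    (hX : X.PosSemidef) : IsStable (A - F * X) :=
  (hL.negForm_closedLoop hF hA hX).isStable_of_conj (hL.isUnit_det hF)

/-- A Lyapunov equation with negative semidefinite right-hand side has a positive semidefinite
solution if its coefficient is similar to a matrix with negative definite form. -/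
theorem posSemidef_of_lyapunov_conj {L M Z : Matrix (Fin n) (Fin n) ℝ} (hL : IsUnit L.det)
    (hM : NegForm (L⁻¹ * M * L)) (hZ : Z.IsSymm) (h : ∀ v, v ⬝ᵥ (Mᵀ * Z + Z * M) *ᵥ v ≤ 0) :
    Z.PosSemidef := by
  have h1 : (L⁻¹)ᵀ * Lᵀ = 1 := by
    rw [← Matrix.transpose_mul, Matrix.mul_nonsing_inv _ hL, Matrix.transpose_one]
  have key : (Lᵀ * Z * L).PosSemidef := by
    refine hM.posSemidef_of_lyapunov (by simp [Matrix.IsSymm, hZ.eq, mul_assoc]) fun v => ?_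
    have e : (L⁻¹ * M * L)ᵀ * (Lᵀ * Z * L) + Lᵀ * Z * L * (L⁻¹ * M * L) =
        Lᵀ * (Mᵀ * Z + Z * M) * L := by
      calc _ = Lᵀ * Mᵀ * ((L⁻¹)ᵀ * Lᵀ) * Z * L + Lᵀ * Z * (L * L⁻¹) * M * L := by
            simp only [Matrix.transpose_mul, mul_assoc]
        _ = _ := by
            rw [h1, Matrix.mul_nonsing_inv _ hL]
            simp only [mul_one, mul_add, add_mul, mul_assoc]
    rw [e, ← Matrix.mulVec_mulVec, ← Matrix.mulVec_mulVec, dotProduct_transpose_mulVec,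
      dotProduct_comm]
    exact h (L *ᵥ v)
  have := posSemidef_congr L⁻¹ key
  have e := congr_cancel hL Z
  rw [Matrix.transpose_transpose] at e
  rwa [e] at this

/-! ### One inexact Newton step preserves positive semidefiniteness -/

/-- Take logarithms. When `ρ = 0`, `Real.log 0 = 0` makes the quotient `0`, so the bound on `m` says
nothing and `m ≠ 0` has to be assumed. -/
theorem sq_mul_pow_le_one {c ρ : ℝ} {m : ℕ} (hc : 0 ≤ c) (hρ0 : 0 ≤ ρ) (hρ1 : ρ < 1)
    (hm : 2 * Real.log c / (-Real.log ρ) ≤ m) (h : ρ ≠ 0 ∨ m ≠ 0) : c ^ 2 * ρ ^ m ≤ 1 := by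
  rcases hc.eq_or_lt with rfl | hc
  · simp
  rcases hρ0.eq_or_lt with rfl | hρ0
  · rw [zero_pow (h.resolve_left (by simp)), mul_zero]
    exact zero_le_one
  have hlog : 0 < -Real.log ρ := neg_pos.2 (Real.log_neg hρ0 hρ1)
  rw [div_le_iff₀ hlog] at hm
  rw [← Real.log_nonpos_iff (by positivity), Real.log_mul (by positivity) (by positivity),
    Real.log_pow, Real.log_pow]
  push_cast
  linarith

theorem posSemidef_of_isGMRESIterate {A F Q L X Z : Matrix (Fin n) (Fin n) ℝ} (hF : F.PosDef)
    (hQ : Q.PosDef) (hL : IsCholeskyFactor F L) (hA : NegForm (L⁻¹ * A * L))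
    (hX : X.PosSemidef) {m : ℕ}
    (hg : IsGMRESIterate (lyapMatrix (A - F * X)) (-Matrix.vec (X * F * X + Q)) m (Matrix.vec Z))
    (hm : gmresBound A F Q L X ≤ m) : Z.PosSemidef := by
  rcases isEmpty_or_nonempty (Fin n) with hn | hn
  · rw [Subsingleton.elim Z 0]
    exact .zero
  have hdet := hL.isUnit_det hF
  have hneg := hL.negForm_closedLoop hF hA hX
  set M := A - F * X
  set P := X * F * X + Q
  set S := scaledLyapMatrix L M
  have hXs : X.IsSymm := isSymm_of_isHermitian hX.isHermitian
  have hFs : F.IsSymm := isSymm_of_isHermitian hF.isHermitian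
  have hQs : Q.IsSymm := isSymm_of_isHermitian hQ.isHermitian
  have hPs : (-P).IsSymm := by
    simp [P, Matrix.IsSymm, hXs.eq, hFs.eq, hQs.eq, mul_assoc]
  rw [← Matrix.vec_neg] at hg
  have hZ : Z.IsSymm := isSymm_of_vec_mem_krylov hPs hg.1
  have hμ : 0 < lambdaMin (-((1 / 2 : ℝ) • (S + Sᵀ))) := by
    simp only [S]
    rw [scaledLyapMatrix_eq hdet]
    exact lambdaMin_pos hneg.posDef_neg_symmPart_lyapMatrix
  have hres := hg.residual_le (T := Lᵀ ⊗ₖ Lᵀ) (scaledLyapMatrix_mul hdet M) hμ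
    (c := specNorm F ^ 2) (d := specNorm F⁻¹ ^ 2) (by positivity)
    (fun v => by
      obtain ⟨W, rfl⟩ := Matrix.vec_bijective.surjective v
      rw [kronecker_mulVec_vec_eq]
      exact hL.vec_congr_le W)
    (fun v => by
      obtain ⟨W, rfl⟩ := Matrix.vec_bijective.surjective v
      rw [kronecker_mulVec_vec_eq]
      exact hL.vec_le_congr hF W)
  have hlQ := lambdaMin_pos hQ
  set E := -P - (Mᵀ * Z + Z * M)
  rw [lyapMatrix_mulVec_vec, ← Matrix.vec_sub] at hres
  have hρ0 := elmanFactor_nonneg hμ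
  have hρ1 := elmanFactor_lt_one hμ
  -- In this degenerate case no residual bound is available, but the Krylov space is trivial and `Z
  -- = 0`.
  by_cases hcase : elmanFactor S = 0 ∧ m = 0
  · have hz := hg.1
    rw [hcase.2] at hz
    have : Matrix.vec Z = 0 := by simpa [krylov] using hz
    rw [Matrix.vec_eq_zero_iff.1 this]
    exact .zero
  have hE : Matrix.vec E ⬝ᵥ Matrix.vec E ≤ lambdaMin Q ^ 2 := by
    have hb : gmresBound A F Q L X = 2 * Real.log ((1 + Real.sqrt 2) *
        (condNumber F * frobNorm P / lambdaMin Q)) / (-Real.log (elmanFactor S)) := rfl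
    rw [hb] at hm
    have hcond : 0 ≤ condNumber F * frobNorm P :=
      mul_nonneg (mul_nonneg (norm_nonneg _) (norm_nonneg _)) (Real.sqrt_nonneg _)
    have h1 := sq_mul_pow_le_one (by positivity) hρ0 hρ1 hm (by tauto)
    have h2 : (condNumber F * frobNorm P / lambdaMin Q) ^ 2 * elmanFactor S ^ m ≤ 1 := by
      refine le_trans ?_ h1
      gcongr
      -- Only `1 + √2 ≥ 1` matters here.
      exact le_mul_of_one_le_left (by positivity) (by linarith [Real.sqrt_nonneg 2])
    have h3 : specNorm F⁻¹ ^ 2 * specNorm F ^ 2 * elmanFactor S ^ m *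
        (Matrix.vec (-P) ⬝ᵥ Matrix.vec (-P)) =
        (condNumber F * frobNorm P / lambdaMin Q) ^ 2 * elmanFactor S ^ m * lambdaMin Q ^ 2 := by
      rw [Matrix.vec_neg, neg_dotProduct_neg, ← frobNorm_sq, condNumber]
      field_simp
    rw [h3] at hres
    exact hres.trans (mul_le_of_le_one_left (by positivity) h2)
  refine posSemidef_of_lyapunov_conj hdet hneg hZ fun v => ?_
  have e : Mᵀ * Z + Z * M = -(X * F * X + Q + E) := by simp only [E, P]; abel
  rw [e, Matrix.neg_mulVec, dotProduct_neg, Matrix.add_mulVec, Matrix.add_mulVec, dotProduct_add,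
    dotProduct_add]
  have h1 : 0 ≤ v ⬝ᵥ (X * F * X) *ᵥ v := by
    have := (hF.posSemidef.conjTranspose_mul_mul_same X).dotProduct_mulVec_nonneg v
    rwa [Matrix.conjTranspose_eq_transpose_of_trivial, hXs.eq, star_trivial] at this
  have h2 := lambdaMin_mul_le hQ.isHermitian v
  have h3 : |v ⬝ᵥ E *ᵥ v| ≤ lambdaMin Q * (v ⬝ᵥ v) := by
    refine abs_le_of_sq_le_sq ?_ (mul_nonneg hlQ.le (dotProduct_self_nonneg_real v))
    rw [mul_pow]
    exact (sq_dotProduct_mulVec_le E v).trans (mul_le_mul_of_nonneg_right hE (sq_nonneg _))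
  linarith [(abs_le.1 h3).1]

/-! ### Solutions of the Riccati equation -/

/-- The difference of the two residuals factors as `(A - F X)ᵀ (Y - X) + (Y - X) (A - F Y)`, a
Sylvester expression in `Y - X`. The identity transposes `F` and `X` only, so `Y` may be
nonsymmetric. -/
theorem eq_of_residual_eq_zero {A F Q X Y : Matrix (Fin n) (Fin n) ℝ} (hF : F.IsSymm)
    (hX : X.IsSymm) (hRX : residual A F Q X = 0) (hRY : residual A F Q Y = 0)
    (hsX : IsStable (A - F * X)) (hsY : IsWeaklyStable (A - F * Y)) : Y = X := by
  refine sub_eq_zero.1 (eq_zero_of_sylvester hsX hsY ?_)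
  have h : (A - F * X)ᵀ * (Y - X) + (Y - X) * (A - F * Y) =
      residual A F Q Y - residual A F Q X := by
    rw [Matrix.transpose_sub, Matrix.transpose_mul, hF.eq, hX.eq, residual, residual]
    noncomm_ring
  rw [h, hRX, hRY, sub_zero]

/-- On a kernel vector of `X` the form of the residual reduces to that of `Q`, which cannot vanish.
-/
theorem posDef_of_residual_eq_zero {A F Q X : Matrix (Fin n) (Fin n) ℝ} (hQ : Q.PosDef)
    (hX : X.PosSemidef) (hR : residual A F Q X = 0) : X.PosDef := by
  have hXs : X.IsSymm := isSymm_of_isHermitian hX.isHermitian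
  refine .of_dotProduct_mulVec_pos hX.isHermitian fun v hv => ?_
  refine (hX.dotProduct_mulVec_nonneg v).lt_of_ne' fun h0 => ?_
  have hXv : X *ᵥ v = 0 := (hX.dotProduct_mulVec_zero_iff v).1 h0
  have h1 : v ⬝ᵥ residual A F Q X *ᵥ v = v ⬝ᵥ Q *ᵥ v := by
    simp only [residual, Matrix.add_mulVec, Matrix.sub_mulVec, ← Matrix.mulVec_mulVec, hXv,
      Matrix.mulVec_zero, zero_add, sub_zero, dotProduct_add]
    rw [← dotProduct_transpose_mulVec X, hXs.eq, hXv, dotProduct_zero, zero_add]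
  have h2 := hQ.dotProduct_mulVec_pos hv
  rw [star_trivial, ← h1, hR, Matrix.zero_mulVec, dotProduct_zero] at h2
  exact h2.false

/-- An a priori bound for a symmetric matrix in terms of its Riccati residual. -/
theorem IsCholeskyFactor.vec_congr_le_of_residual {A F Q L X : Matrix (Fin n) (Fin n) ℝ}
    (hL : IsCholeskyFactor F L) (hF : F.PosDef) (hX : X.IsSymm) :
    Matrix.vec (Lᵀ * X * L) ⬝ᵥ Matrix.vec (Lᵀ * X * L) ≤
      4 * (Matrix.vec (L⁻¹ * A * L) ⬝ᵥ Matrix.vec (L⁻¹ * A * L)) +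
        2 * (Lᵀ * (Q - residual A F Q X) * L).trace := by
  have hdet := hL.isUnit_det hF
  set B := L⁻¹ * A * L
  set Y := Lᵀ * X * L
  have hY : Yᵀ = Y := by simp [Y, hX.eq, mul_assoc]
  have h1 : (L⁻¹)ᵀ * Lᵀ = 1 := by
    rw [← Matrix.transpose_mul, Matrix.mul_nonsing_inv _ hdet, Matrix.transpose_one]
  have e : Lᵀ * (Q - residual A F Q X) * L = Yᵀ * Y - (Bᵀ * Y + Yᵀ * B) := by
    have e1 : Bᵀ * Y = Lᵀ * (Aᵀ * X) * L := by
      calc _ = Lᵀ * Aᵀ * ((L⁻¹)ᵀ * Lᵀ) * X * L := by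
            simp only [B, Y, Matrix.transpose_mul, mul_assoc]
        _ = _ := by rw [h1]; simp only [mul_one, mul_assoc]
    have e2 : Y * B = Lᵀ * (X * A) * L := by
      calc _ = Lᵀ * X * (L * L⁻¹) * A * L := by simp only [B, Y, mul_assoc]
        _ = _ := by rw [Matrix.mul_nonsing_inv _ hdet]; simp only [mul_one, mul_assoc]
    have e3 : Y * Y = Lᵀ * (X * F * X) * L := by
      simp only [Y, mul_assoc]
      conv_rhs => rw [hL.eq]
      simp only [mul_assoc]
    rw [hY, e1, e2, e3, residual]
    noncomm_ring
  rw [e, Matrix.trace_sub, Matrix.trace_add, ← Matrix.vec_dotProduct_vec,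
    ← Matrix.vec_dotProduct_vec, ← Matrix.vec_dotProduct_vec]
  -- The trace is `‖Y‖² - 2⟨B, Y⟩`. Expanding `‖Y - 2B‖² ≥ 0` absorbs the cross term into half of
  -- `‖Y‖²`, which gives the constants `4` and `2`.
  have h2 := dotProduct_self_nonneg_real (Matrix.vec Y - (2 : ℝ) • Matrix.vec B)
  simp only [dotProduct_sub, sub_dotProduct, dotProduct_smul, smul_dotProduct, smul_eq_mul] at h2
  have h3 := dotProduct_comm (Matrix.vec B) (Matrix.vec Y)
  linarith

/-! ### Limits -/

theorem continuous_residual (A F Q : Matrix (Fin n) (Fin n) ℝ) : Continuous (residual A F Q) := by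
  unfold residual
  fun_prop

theorem isClosed_posSemidef :
    IsClosed {X : Matrix (Fin n) (Fin n) ℝ | X.PosSemidef} := by
  have : {X : Matrix (Fin n) (Fin n) ℝ | X.PosSemidef} =
      {X | Xᴴ = X} ∩ ⋂ v : Fin n → ℝ, {X | 0 ≤ star v ⬝ᵥ X *ᵥ v} := by
    ext X
    simp [Matrix.posSemidef_iff_dotProduct_mulVec, Matrix.IsHermitian]
  rw [this]
  refine (isClosed_eq (by fun_prop) (by fun_prop)).inter (isClosed_iInter fun v => ?_)
  exact isClosed_le continuous_const (by fun_prop)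

theorem isCompact_posSemidef_bounded (C : ℝ) :
    IsCompact {X : Matrix (Fin n) (Fin n) ℝ | X.PosSemidef ∧ ∀ i j, X i j ∈ Set.Icc (-C) C} := by
  have h : IsCompact {X : Fin n → Fin n → ℝ | ∀ i j, X i j ∈ Set.Icc (-C) C} := by
    have := isCompact_univ_pi (X := fun _ : Fin n => Fin n → ℝ) (s := fun _ => Set.pi Set.univ
      fun _ => Set.Icc (-C) C) fun _ => isCompact_univ_pi fun _ => isCompact_Icc
    convert this using 1
    ext X
    simp only [Set.mem_pi, Set.mem_univ, forall_const, Set.mem_ofPred_eq]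
  exact IsCompact.inter_left (X := Matrix (Fin n) (Fin n) ℝ) h isClosed_posSemidef

theorem tendsto_of_abs_le_specNorm {R : ℕ → Matrix (Fin n) (Fin n) ℝ}
    (h : Tendsto (fun k => specNorm (R k)) atTop (𝓝 0)) : Tendsto R atTop (𝓝 0) := by
  refine tendsto_pi_nhds.2 fun i => tendsto_pi_nhds.2 fun j => ?_
  exact squeeze_zero_norm (fun k => abs_le_specNorm (R k) i j) h

theorem continuous_frobNorm : Continuous (frobNorm : Matrix (Fin n) (Fin n) ℝ → ℝ) := by
  unfold frobNorm
  fun_prop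

theorem tendsto_zero_of_line_search {r lam : ℕ → ℝ} {α lamBar : ℝ} (hr : ∀ k, 0 ≤ r k)
    (hα : 0 < α) (hbar : 0 < lamBar) (hlam : ∀ k, lamBar ≤ lam k)
    (h : ∀ k, r (k + 1) ≤ (1 - lam k * α) * r k) : Tendsto r atTop (𝓝 0) := by
  -- The maximum keeps the ratio nonnegative even when `lamBar * α > 1`.
  set q := max 0 (1 - lamBar * α)
  have hq1 : q < 1 := max_lt one_pos (by linarith [mul_pos hbar hα])
  have hq (k : ℕ) : r k ≤ q ^ k * r 0 := by
    induction k with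
    | zero => simp
    | succ k ih =>
      calc r (k + 1) ≤ (1 - lam k * α) * r k := h k
        _ ≤ q * r k := by
          refine mul_le_mul_of_nonneg_right (le_max_of_le_right ?_) (hr k)
          linarith [mul_le_mul_of_nonneg_right (hlam k) hα.le]
        _ ≤ q * (q ^ k * r 0) := mul_le_mul_of_nonneg_left ih (le_max_left _ _)
        _ = q ^ (k + 1) * r 0 := by ring
  refine squeeze_zero hr hq ?_
  simpa using (tendsto_pow_atTop_nhds_zero_of_lt_one (le_max_left _ _) hq1).mul_const (r 0)

/-! ### Positivity and residual decay along the iteration -/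

namespace IsNewtonKleinmanRun

variable {A F Q L : Matrix (Fin n) (Fin n) ℝ} {α : ℝ} {X Xhat : ℕ → Matrix (Fin n) (Fin n) ℝ}
  {lam : ℕ → ℝ} {it : ℕ → ℕ}

theorem posSemidef (hrun : IsNewtonKleinmanRun A F Q α X Xhat lam it) (hF : F.PosDef)
    (hQ : Q.PosDef) (hL : IsCholeskyFactor F L) (hA : NegForm (L⁻¹ * A * L))
    (hX0 : (X 0).PosSemidef) (hit : ∀ k, gmresBound A F Q L (X k) ≤ (it k : ℝ)) (k : ℕ) :
    (X k).PosSemidef := by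
  induction k with
  | zero => exact hX0
  | succ k ih =>
    rw [hrun.update k]
    exact (ih.smul (sub_nonneg.2 (hrun.step_mem k).2)).add
      ((posSemidef_of_isGMRESIterate hF hQ hL hA ih (hrun.gmres k) (hit k)).smul
        (hrun.step_mem k).1.le)

theorem tendsto_residual (hrun : IsNewtonKleinmanRun A F Q α X Xhat lam it) (hα : 0 < α)
    (hlam : ∃ lamBar : ℝ, 0 < lamBar ∧ ∀ k, lamBar ≤ lam k) :
    Tendsto (fun k => residual A F Q (X k)) atTop (𝓝 0) := by
  obtain ⟨lamBar, hbar, hle⟩ := hlam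
  refine tendsto_of_abs_le_specNorm (tendsto_zero_of_line_search (fun k => norm_nonneg _) hα hbar
    hle fun k => ?_)
  rw [hrun.update k]
  exact hrun.line_search k

end IsNewtonKleinmanRun

theorem exists_abs_le_of_tendsto_residual {A F Q L : Matrix (Fin n) (Fin n) ℝ}
    {X : ℕ → Matrix (Fin n) (Fin n) ℝ} (hF : F.PosDef) (hL : IsCholeskyFactor F L)
    (hX : ∀ k, (X k).IsSymm) (hR : Tendsto (fun k => residual A F Q (X k)) atTop (𝓝 0)) :
    ∃ C : ℝ, ∀ k i j, X k i j ∈ Set.Icc (-C) C := by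
  have ht : Tendsto (fun k => (Lᵀ * (Q - residual A F Q (X k)) * L).trace) atTop
      (𝓝 (Lᵀ * (Q - 0) * L).trace) := by
    have hc : Continuous fun R : Matrix (Fin n) (Fin n) ℝ => (Lᵀ * (Q - R) * L).trace := by
      fun_prop
    exact (hc.tendsto 0).comp hR
  obtain ⟨c, hc⟩ := ht.bddAbove_range
  set a := specNorm F⁻¹ ^ 2 *
    (4 * (Matrix.vec (L⁻¹ * A * L) ⬝ᵥ Matrix.vec (L⁻¹ * A * L)) + 2 * c)
  refine ⟨Real.sqrt a, fun k i j => abs_le.1 (Real.abs_le_sqrt ?_)⟩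
  have h1 : X k i j ^ 2 ≤ Matrix.vec (X k) ⬝ᵥ Matrix.vec (X k) := by
    simpa [dotProduct, Matrix.vec, pow_two] using
      Finset.single_le_sum (f := fun p : Fin n × Fin n => X k p.2 p.1 * X k p.2 p.1)
        (fun p _ => mul_self_nonneg _) (Finset.mem_univ (j, i))
  refine h1.trans ((hL.vec_le_congr hF (X k)).trans (mul_le_mul_of_nonneg_left
    ((hL.vec_congr_le_of_residual hF (hX k) (A := A) (Q := Q)).trans ?_) (by positivity)))
  have := hc ⟨k, rfl⟩
  simp only at this
  linarith

/-- Positive semidefinite matrices whose Riccati residuals tend to zero converge to the stabilizing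
solution of the Riccati equation. -/
theorem exists_stabilizing_limit {A F Q L : Matrix (Fin n) (Fin n) ℝ}
    {X : ℕ → Matrix (Fin n) (Fin n) ℝ} (hF : F.PosDef) (hQ : Q.PosDef) (hL : IsCholeskyFactor F L)
    (hA : NegForm (L⁻¹ * A * L)) (hX : ∀ k, (X k).PosSemidef)
    (hR : Tendsto (fun k => residual A F Q (X k)) atTop (𝓝 0)) :
    ∃ Xstar : Matrix (Fin n) (Fin n) ℝ, Xstar.PosDef ∧ residual A F Q Xstar = 0 ∧
      IsStable (A - F * Xstar) ∧
      (∀ Y : Matrix (Fin n) (Fin n) ℝ, residual A F Q Y = 0 →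
        IsWeaklyStable (A - F * Y) → Y = Xstar) ∧
      Tendsto X atTop (𝓝 Xstar) := by
  have symm {Z : Matrix (Fin n) (Fin n) ℝ} (hZ : Z.PosSemidef) : Z.IsSymm := isSymm_of_isHermitian hZ.isHermitian
  obtain ⟨C, hC⟩ := exists_abs_le_of_tendsto_residual hF hL (fun k => symm (hX k)) hR
  have hK := isCompact_posSemidef_bounded (n := n) C
  have hmem : ∀ᶠ k in atTop, X k ∈ {X : Matrix (Fin n) (Fin n) ℝ | X.PosSemidef ∧
      ∀ i j, X i j ∈ Set.Icc (-C) C} := .of_forall fun k => ⟨hX k, hC k⟩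
  have hzero {Z : Matrix (Fin n) (Fin n) ℝ} (hZ : MapClusterPt Z atTop X) :
      residual A F Q Z = 0 := by
    have h1 : MapClusterPt (residual A F Q Z) atTop (residual A F Q ∘ X) :=
      hZ.continuousAt_comp (continuous_residual A F Q).continuousAt
    have : NeBot (𝓝 (residual A F Q Z) ⊓ 𝓝 0) := NeBot.mono h1 (inf_le_inf_left _ hR)
    exact eq_of_nhds_neBot this
  obtain ⟨Xstar, ⟨hpsd, -⟩, hcl⟩ := hK.exists_mapClusterPt_of_frequently hmem.frequently
  have hstab := hL.isStable_closedLoop hF hA hpsd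
  have huniq (Y : Matrix (Fin n) (Fin n) ℝ) (h1 : residual A F Q Y = 0)
      (h2 : IsWeaklyStable (A - F * Y)) : Y = Xstar :=
    eq_of_residual_eq_zero (symm hF.posSemidef) (symm hpsd) (hzero hcl) h1 hstab h2
  refine ⟨Xstar, posDef_of_residual_eq_zero hQ hpsd (hzero hcl), hzero hcl, hstab, huniq, ?_⟩
  -- A sequence in a compact set with a single cluster point converges; another cluster point would
  -- again be a positive semidefinite, hence stabilizing, solution.
  refine hK.tendsto_nhds_of_unique_mapClusterPt hmem fun Z hZ hZcl => huniq Z (hzero hZcl) ?_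
  exact fun μ hμ => (hL.isStable_closedLoop hF hA hZ.1 μ hμ).le

end Riccati

theorem corollary3p2 {n : ℕ} (A F Q L : Matrix (Fin n) (Fin n) ℝ)
    (hF : F.PosDef) (hQ : Q.PosDef)
    (hL : Riccati.IsCholeskyFactor F L)
    (hW : ∀ z ∈ Riccati.numericalRange (L⁻¹ * A * L), z.re < 0)
    (X Xhat : ℕ → Matrix (Fin n) (Fin n) ℝ) (lam : ℕ → ℝ) (it : ℕ → ℕ)
    (α : ℝ) (hα : 0 < α)
    (hX0 : (X 0).PosSemidef) (hstable0 : Riccati.IsStable (A - F * X 0))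
    (hrun : Riccati.IsNewtonKleinmanRun A F Q α X Xhat lam it)
    (hit : ∀ k, Riccati.gmresBound A F Q L (X k) ≤ (it k : ℝ))
    (hlam : ∃ lamBar : ℝ, 0 < lamBar ∧ ∀ k, lamBar ≤ lam k) :
    Tendsto (fun k => Riccati.frobNorm (Riccati.residual A F Q (X k))) atTop (𝓝 0) ∧
    ∃ Xstar : Matrix (Fin n) (Fin n) ℝ,
      Xstar.PosDef ∧
      Riccati.residual A F Q Xstar = 0 ∧
      Riccati.IsStable (A - F * Xstar) ∧
      (∀ Y : Matrix (Fin n) (Fin n) ℝ, Riccati.residual A F Q Y = 0 →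
        Riccati.IsWeaklyStable (A - F * Y) → Y = Xstar) ∧
      Tendsto X atTop (𝓝 Xstar) := by
  have hA := Riccati.negForm_of_numericalRange hW
  have hR := hrun.tendsto_residual hα hlam
  refine ⟨?_, Riccati.exists_stabilizing_limit hF hQ hL hA
    (hrun.posSemidef hF hQ hL hA hX0 hit) hR⟩
  have h0 : Riccati.frobNorm (0 : Matrix (Fin n) (Fin n) ℝ) = 0 := by simp [Riccati.frobNorm]
  have h := (Riccati.continuous_frobNorm.tendsto (0 : Matrix (Fin n) (Fin n) ℝ)).comp hR
  rwa [h0] at h
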